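/- Let $D$ be a Prüfer domain (an integral domain all of whose localizations at prime ideals are valuation domains) with quotient field $K$. A set $X\subseteq\mathrm{Spec}(D)$ is a *splitting set* if it is closed under specialization (if $P\in X$ and $P\subseteq Q\in\mathrm{Spec}(D)$, then $Q\in X$) and $\mathrm{Spec}(D)\setminus X$ is compact in the Zariski topology; it is *discrete* if moreover $P\neq P^2$ for every $P\in X$. The *support* of a fractional ideal $I$ of $D$ is $\mathrm{supp}(I)=\{P\in\mathrm{Spec}(D) : ID_P\neq D_P\}$, and $\mathrm{Inv}_X(D)$ is the set of invertible fractional ideals $I$ of $D$ with $\mathrm{supp}(I)\subseteq X$. An ideal $M\in X$ is *critical with respect to $X$* if there is no radical ideal $I\in\mathrm{Inv}_X(D)$ with $I\subseteq M$; $\mathrm{Crit}_X(D)$ denotes the set of all $M\in X$ that are critical with respect to $X$. **Theorem.** Let $D$ be a Prüfer domain and let $X\subseteq\mathrm{Max}(D)$ be a nonempty discrete splitting set of $D$. Then $\mathrm{Crit}_X(D)\neq X$, i.e., some maximal ideal in $X$ is not critical with respect to $X$. -/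

import Mathlib

open scoped nonZeroDivisors

/-- A Prüfer domain: an integral domain all of whose localizations at prime ideals are
valuation domains. -/
def IsPruferDomain (D : Type*) [CommRing D] [IsDomain D] : Prop :=
  ∀ (P : Ideal D) [P.IsPrime], ValuationRing (Localization.AtPrime P)

section Support

variable {D : Type*} [CommRing D] [IsDomain D] (K : Type*) [Field K] [Algebra D K]
  [IsFractionRing D K]

/-- The localization `D_P`, as the subring `{a / s | a ∈ D, s ∈ D ∖ P}` of the quotient field
`K` of `D`. -/
noncomputable def locAt (P : PrimeSpectrum D) : Subalgebra D K :=
  Localization.subalgebra.ofField K P.asIdeal.primeCompl P.asIdeal.primeCompl_le_nonZeroDivisors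

/-- The support `{P ∈ Spec D | I D_P ≠ D_P}` of a fractional ideal `I` of `D`; the product
`I D_P` is taken among the `D`-submodules of `K`. -/
def fracSupport (I : FractionalIdeal D⁰ K) : Set (PrimeSpectrum D) :=
  {P | (I : Submodule D K) * Subalgebra.toSubmodule (locAt K P) ≠
    Subalgebra.toSubmodule (locAt K P)}

/-- `Inv_X(D)`: the invertible fractional ideals of `D` whose support is contained in `X`. -/
def invSet (X : Set (PrimeSpectrum D)) : Set (FractionalIdeal D⁰ K)ˣ :=
  {I | fracSupport K (I : FractionalIdeal D⁰ K) ⊆ X}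

/-- `Crit_X(D)`: the elements `M` of `X` that are critical with respect to `X`, i.e. such that no
radical ideal contained in `M` belongs to `Inv_X(D)`. -/
def critSet (X : Set (PrimeSpectrum D)) : Set (PrimeSpectrum D) :=
  {M | M ∈ X ∧ ¬ ∃ I : Ideal D, I.IsRadical ∧ I ≤ M.asIdeal ∧
    ∃ u ∈ invSet K X, (u : FractionalIdeal D⁰ K) = (I : FractionalIdeal D⁰ K)}

end Support

/-- A splitting set of `D`: a set of prime ideals that is closed under specialization (passing to
larger prime ideals) and whose complement in `Spec D` is compact in the Zariski topology. -/
structure IsSplittingSet {D : Type*} [CommRing D] (X : Set (PrimeSpectrum D)) : Prop where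
  isUpperSet : IsUpperSet X
  isCompact_compl : IsCompact Xᶜ

/-- A splitting set is discrete if none of its elements is idempotent. -/
structure IsDiscreteSplittingSet {D : Type*} [CommRing D] (X : Set (PrimeSpectrum D)) : Prop
    extends IsSplittingSet X where
  ne_sq : ∀ P ∈ X, P.asIdeal ≠ P.asIdeal ^ 2

/-!
For a prime `P` and `a : D` the argument works with the ideals `locSpan P a = a D_P ∩ D`; that
`D_P` is a valuation ring says that of any two such ideals, one contains the generator of the
other (`IsPruferDomain.mem_locSpan_total`).

Since `Xᶜ` is compact, every `M ∈ X` contains a finitely generated ideal whose zero locus lies in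
`X` (`exists_fg_le_zeroLocus_subset`). A nonzero finitely generated ideal of `D` is invertible
(`IsPruferDomain.isUnit_coeIdeal`), so, if every element of `X` is critical, no proper finitely
generated ideal `L` with `V(L) ⊆ X` is radical. Given such an `L`, choose `x ∈ √L ∖ L` and a
maximal ideal `N ⊇ (L : x)`. As `N ≠ N²`, the ideal `N D_N` is generated by one element `t`, and
`L D_N ⊊ x D_N ⊆ t D_N` forces `L D_N ⊆ t² D_N`. Adjoining to `L` the element `t` and an element
of `N` that is invertible modulo the denominator occurring here yields a proper finitely
generated ideal `L'` with `L ≤ L'²` (`IsPruferDomain.exists_fg_le_sq`).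

Iteration gives ideals `L₀ ≤ L₁²`, `L₁ ≤ L₂²`, …, hence `L₀ ≤ Lₙ ^ 2 ^ n` for all `n`. Their union
is proper, so it lies in a maximal ideal `M`, and `L₀ ≤ ⋂ Mⁿ`. But `⋂ tⁿ D_M ∩ D` is a prime
ideal strictly below `M` (`IsPruferDomain.isPrime_iInf_locSpan_pow`); it contains `L₀`, so it
belongs to `X`, contrary to `X ⊆ Max(D)`.
-/

/-! ### Principal ideals of a localization, contracted -/

section LocSpan

variable {D : Type*} [CommRing D]

/-- The contraction `a D_P ∩ D` of the principal ideal of `D_P` generated by `a`. It is described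
without mention of `D_P`: it consists of the `y` such that `a` divides `s * y` for some
`s ∉ P`. -/
def locSpan (P : Ideal D) [P.IsPrime] (a : D) : Ideal D where
  carrier := {y | ∃ s ∉ P, a ∣ s * y}
  zero_mem' := ⟨1, P.one_notMem, by simp⟩
  add_mem' := by
    rintro y z ⟨s, hs, hy⟩ ⟨r, hr, hz⟩
    refine ⟨s * r, P.primeCompl.mul_mem hs hr, ?_⟩
    rw [show s * r * (y + z) = s * y * r + r * z * s by ring]
    exact dvd_add (hy.mul_right r) (hz.mul_right s)
  smul_mem' := by
    rintro c y ⟨s, hs, hy⟩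
    refine ⟨s, hs, ?_⟩
    rw [smul_eq_mul, show s * (c * y) = s * y * c by ring]
    exact hy.mul_right c

theorem mul_mem_locSpan_mul {P : Ideal D} [P.IsPrime] {a b y z : D} (hy : y ∈ locSpan P a)
    (hz : z ∈ locSpan P b) : y * z ∈ locSpan P (a * b) := by
  obtain ⟨s, hs, hy⟩ := hy
  obtain ⟨r, hr, hz⟩ := hz
  refine ⟨s * r, P.primeCompl.mul_mem hs hr, ?_⟩
  rw [mul_mul_mul_comm]
  exact mul_dvd_mul hy hz

theorem le_locSpan_pow {P : Ideal D} [P.IsPrime] {t : D} (ht : P ≤ locSpan P t) (n : ℕ) :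
    P ^ n ≤ locSpan P (t ^ n) := by
  induction n with
  | zero => exact fun y _ => ⟨1, P.one_notMem, by simp⟩
  | succ n ih =>
    rw [pow_succ, pow_succ, Ideal.mul_le]
    exact fun y hy z hz => mul_mem_locSpan_mul (ih hy) (ht hz)

end LocSpan

/-! ### Finitely generated ideals of a Prüfer domain -/

namespace IsPruferDomain

variable {D : Type*} [CommRing D] [IsDomain D]

theorem mem_locSpan_total (hD : IsPruferDomain D) (P : Ideal D) [P.IsPrime] (a b : D) :
    b ∈ locSpan P a ∨ a ∈ locSpan P b := by
  have key : ∀ x y : D, algebraMap D (Localization.AtPrime P) x ∣ algebraMap D _ y →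
      y ∈ locSpan P x := by
    rintro x y ⟨z, hz⟩
    obtain ⟨⟨c, s⟩, hc⟩ := IsLocalization.surj P.primeCompl z
    refine ⟨s, s.2, c, ?_⟩
    apply IsLocalization.injective (Localization.AtPrime P) P.primeCompl_le_nonZeroDivisors
    rw [map_mul, map_mul, hz, ← hc]
    ring
  have := hD P
  exact (ValuationRing.dvd_total (algebraMap D (Localization.AtPrime P) a)
    (algebraMap D _ b)).imp (key a b) (key b a)

/-- A finitely generated ideal becomes principal in `D_P`, with a common denominator. -/
theorem exists_dvd_mul_of_fg (hD : IsPruferDomain D) (P : Ideal D) [P.IsPrime] {J : Ideal D}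
    (hJ : J.FG) :
    ∃ a ∈ J, ∃ s ∉ P, ∀ y ∈ J, a ∣ s * y := by
  induction J, hJ using Submodule.fg_induction with
  | singleton x =>
    refine ⟨x, Submodule.mem_span_singleton_self x, 1, P.one_notMem, fun y hy => ?_⟩
    rw [one_mul]
    exact Ideal.mem_span_singleton.1 hy
  | sup J₁ J₂ _ _ h₁ h₂ =>
    -- The local generator of the sum is the larger one of the two local generators.
    have aux : ∀ J₁ J₂ : Ideal D, ∀ a₁ a₂ : D, a₁ ∈ J₁ →
        (∃ s ∉ P, ∀ y ∈ J₁, a₁ ∣ s * y) → (∃ s ∉ P, ∀ y ∈ J₂, a₂ ∣ s * y) →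
        a₂ ∈ locSpan P a₁ → ∃ a ∈ J₁ ⊔ J₂, ∃ s ∉ P, ∀ y ∈ J₁ ⊔ J₂, a ∣ s * y := by
      rintro J₁ J₂ a₁ a₂ ha₁ ⟨s₁, hs₁, h₁⟩ ⟨s₂, hs₂, h₂⟩ ⟨r, hr, h⟩
      refine ⟨a₁, Ideal.mem_sup_left ha₁, r * s₁ * s₂,
        P.primeCompl.mul_mem (P.primeCompl.mul_mem hr hs₁) hs₂, fun y hy => ?_⟩
      obtain ⟨y₁, hy₁, y₂, hy₂, rfl⟩ := Submodule.mem_sup.1 hy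
      rw [show r * s₁ * s₂ * (y₁ + y₂) = s₁ * y₁ * (r * s₂) + r * (s₂ * y₂) * s₁ by ring]
      exact dvd_add ((h₁ y₁ hy₁).mul_right _)
        ((h.trans (mul_dvd_mul_left r (h₂ y₂ hy₂))).mul_right _)
    obtain ⟨a₁, ha₁, h₁⟩ := h₁
    obtain ⟨a₂, ha₂, h₂⟩ := h₂
    rcases hD.mem_locSpan_total P a₁ a₂ with h | h
    · exact aux J₁ J₂ a₁ a₂ ha₁ h₁ h₂ h
    · rw [sup_comm]
      exact aux J₂ J₁ a₂ a₁ ha₂ h₂ h₁ h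

/-- A nonzero finitely generated ideal `J` is invertible: `J * J⁻¹` contains, for every maximal
ideal `P`, a common denominator outside `P` of a generator of `J D_P`. -/
theorem isUnit_coeIdeal (hD : IsPruferDomain D) (K : Type*) [Field K] [Algebra D K]
    [IsFractionRing D K] {J : Ideal D} (hJ : J.FG) (hJ0 : J ≠ ⊥) :
    IsUnit (J : FractionalIdeal D⁰ K) := by
  have hJ0' : (J : FractionalIdeal D⁰ K) ≠ 0 := FractionalIdeal.coeIdeal_ne_zero.2 hJ0
  rw [← FractionalIdeal.mul_inv_cancel_iff_isUnit]
  obtain ⟨I, hI⟩ := FractionalIdeal.le_one_iff_exists_coeIdeal.1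
    (FractionalIdeal.mul_one_div_le_one (K := K) (I := (J : FractionalIdeal D⁰ K)))
  rw [← FractionalIdeal.inv_eq] at hI
  suffices I = ⊤ by rw [← hI, this, FractionalIdeal.coeIdeal_top]
  by_contra hne
  obtain ⟨P, hP, hIP⟩ := Ideal.exists_le_maximal I hne
  obtain ⟨a, ha, s, hs, hdvd⟩ := hD.exists_dvd_mul_of_fg P hJ
  have ha0 : a ≠ 0 := by
    rintro rfl
    refine hJ0 ((Submodule.eq_bot_iff J).2 fun y hy => ?_)
    refine (mul_eq_zero.1 (zero_dvd_iff.1 (hdvd y hy))).resolve_left ?_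
    rintro rfl
    exact hs P.zero_mem
  have haK : algebraMap D K a ≠ 0 := by simpa using ha0
  have hinv : algebraMap D K s / algebraMap D K a ∈ (J : FractionalIdeal D⁰ K)⁻¹ := by
    rw [FractionalIdeal.mem_inv_iff hJ0']
    intro y hy
    obtain ⟨z, hz, rfl⟩ := (FractionalIdeal.mem_coeIdeal _).1 hy
    obtain ⟨c, hc⟩ := hdvd z hz
    rw [div_mul_eq_mul_div, ← map_mul, hc, map_mul, mul_div_cancel_left₀ _ haK]
    exact (FractionalIdeal.mem_one_iff _).2 ⟨c, rfl⟩
  have hmem := FractionalIdeal.mul_mem_mul (FractionalIdeal.mem_coeIdeal_of_mem D⁰ ha) hinv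
  rw [mul_div_cancel₀ _ haK, ← hI] at hmem
  obtain ⟨s', hs', h⟩ := (FractionalIdeal.mem_coeIdeal _).1 hmem
  exact hs (hIP (IsFractionRing.injective D K h ▸ hs'))

/-! ### Non-idempotent maximal ideals -/

/-- At a non-idempotent maximal ideal `N`, the maximal ideal of `D_N` is principal: any
`t ∈ N \ N²` generates it. -/
theorem exists_le_locSpan (hD : IsPruferDomain D) {N : Ideal D} [N.IsMaximal]
    (hne : N ≠ N ^ 2) : ∃ t ∈ N, t ≠ 0 ∧ N ≤ locSpan N t := by
  obtain ⟨t, ht, ht2⟩ :=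
    Set.not_subset.1 fun h => hne (le_antisymm h (Ideal.pow_le_self two_ne_zero))
  refine ⟨t, ht, fun h => ht2 (h ▸ Ideal.zero_mem _), fun y hy => ?_⟩
  refine (hD.mem_locSpan_total N t y).elim id ?_
  rintro ⟨s, hs, c, hc⟩
  by_cases hcN : c ∈ N
  · have hmem : s * t ∈ N ^ 2 := by
      rw [hc, pow_two]
      exact Ideal.mul_mem_mul hy hcN
    exact ((Ideal.IsMaximal.mul_mem_pow N hmem).elim hs ht2).elim
  · exact ⟨c, hcN, s, by rw [mul_comm t, hc, mul_comm]⟩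

/-- The prime ideal `⋂ tⁿ D_P ∩ D` lies strictly below `P` when `t ∈ P` is nonzero. -/
theorem isPrime_iInf_locSpan_pow (hD : IsPruferDomain D) {P : Ideal D} [P.IsPrime] {t : D}
    (ht : t ∈ P) (ht0 : t ≠ 0) :
    (⨅ n : ℕ, locSpan P (t ^ n)).IsPrime ∧ t ∉ ⨅ n : ℕ, locSpan P (t ^ n) := by
  have cancel : ∀ n, ∀ r ∉ P, r * t ^ n ∉ locSpan P (t ^ (n + 1)) := by
    rintro n r hr ⟨s, hs, c, hc⟩
    refine P.primeCompl.mul_mem hs hr ?_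
    rw [mul_left_cancel₀ (pow_ne_zero n ht0) (show t ^ n * (s * r) = t ^ n * (t * c) by
      rw [← mul_assoc (t ^ n) t, ← pow_succ, ← hc]; ring)]
    exact P.mul_mem_right _ ht
  refine ⟨⟨?_, ?_⟩, fun h => ?_⟩
  · rw [Ideal.ne_top_iff_one]
    intro h
    refine cancel 0 1 P.one_notMem ?_
    simpa using (Ideal.mem_iInf.1 h) 1
  · intro x y hxy
    by_contra! hcon
    obtain ⟨hx, hy⟩ := hcon
    simp only [Ideal.mem_iInf, not_forall] at hx hy
    obtain ⟨n, hn⟩ := hx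
    obtain ⟨m, hm⟩ := hy
    obtain ⟨r, hr, c, hc⟩ := (hD.mem_locSpan_total P (t ^ n) x).resolve_left hn
    obtain ⟨s, hs, d, hd⟩ := (hD.mem_locSpan_total P (t ^ m) y).resolve_left hm
    refine cancel (n + m) (r * s) (P.primeCompl.mul_mem hr hs) ?_
    rw [show r * s * t ^ (n + m) = c * d * (x * y) by
      rw [pow_add, mul_mul_mul_comm, hc, hd]; ring]
    exact Ideal.mul_mem_left _ _ (Ideal.mem_iInf.1 hxy _)
  · refine cancel 1 1 P.one_notMem ?_
    simpa using (Ideal.mem_iInf.1 h) 2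

/-- If all maximal ideals containing `L` are non-idempotent and `L` is finitely generated but not
radical, then `L` lies in the square of a larger proper finitely generated ideal. -/
theorem exists_fg_le_sq (hD : IsPruferDomain D) {L : Ideal D} (hL : L.FG)
    (hne : ∀ N : Ideal D, N.IsMaximal → L ≤ N → N ≠ N ^ 2) (hrad : ¬ L.IsRadical) :
    ∃ L' : Ideal D, L'.FG ∧ L' ≠ ⊤ ∧ L ≤ L' ∧ L ≤ L' ^ 2 := by
  obtain ⟨x, hx, hxL⟩ := Set.not_subset.1 hrad
  -- A maximal ideal `N ⊇ (L : x)` is one at which `x ∉ L D_N`.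
  have hcol : Submodule.colon L {x} ≠ ⊤ := by
    rw [Ideal.ne_top_iff_one]
    intro h
    exact hxL (by simpa using Submodule.mem_colon_singleton.1 h)
  obtain ⟨N, hN, hcolN⟩ := Ideal.exists_le_maximal _ hcol
  have hcol_mem : ∀ {d : D}, d * x ∈ L → d ∈ N := fun {d} h =>
    hcolN (Submodule.mem_colon_singleton.2 h)
  have hLN : L ≤ N := fun l hl => hcol_mem (L.mul_mem_right x hl)
  have hxN : x ∈ N := (Ideal.IsPrime.radical_le_iff hN.isPrime).2 hLN hx
  obtain ⟨t, ht, -, htN⟩ := hD.exists_le_locSpan (hne N hN hLN)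
  obtain ⟨a, ha, s, hs, hdvd⟩ := hD.exists_dvd_mul_of_fg N hL
  -- The generator `a` of `L D_N` is a multiple of `x` by a non-unit of `D_N`.
  have hat : a ∈ locSpan N (t * t) := by
    rcases hD.mem_locSpan_total N a x with ⟨r, hr, h⟩ | ⟨r, hr, d, hd⟩
    · exact (hr (hcol_mem (L.mem_of_dvd h ha))).elim
    · have hdN : d ∈ N := hcol_mem (by rw [mul_comm, ← hd]; exact L.mul_mem_left r ha)
      obtain ⟨q, hq, h⟩ := mul_mem_locSpan_mul (htN hxN) (htN hdN)
      exact ⟨q * r, N.primeCompl.mul_mem hq hr, by rwa [mul_assoc, hd]⟩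
  obtain ⟨r, hr, hra⟩ := hat
  obtain ⟨u, e, he, hue⟩ := hN.exists_inv (N.primeCompl.mul_mem hr hs)
  refine ⟨L ⊔ Ideal.span {t, e}, Submodule.FG.sup hL (Submodule.fg_span (Set.toFinite _)),
    fun h => hN.ne_top ?_, le_sup_left, fun l hl => ?_⟩
  · rw [eq_top_iff, ← h, sup_le_iff, Ideal.span_le]
    exact ⟨hLN, by rintro _ (rfl | rfl) <;> assumption⟩
  · have htL : t ∈ L ⊔ Ideal.span {t, e} :=
      Ideal.mem_sup_right (Ideal.subset_span (by simp))
    have heL : e ∈ L ⊔ Ideal.span {t, e} :=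
      Ideal.mem_sup_right (Ideal.subset_span (by simp))
    have hl' : t * t ∣ r * s * l := by
      rw [mul_assoc]
      exact hra.trans (mul_dvd_mul_left r (hdvd l hl))
    -- As `u * (r * s) + e = 1`, the element `l` splits into two summands in the square.
    rw [show l = u * (r * s * l) + e * l by linear_combination (-l) * hue, pow_two]
    exact add_mem (Ideal.mul_mem_left _ _ (Ideal.mem_of_dvd _ hl' (Ideal.mul_mem_mul htL htL)))
      (Ideal.mul_mem_mul heL (Ideal.mem_sup_left hl))

end IsPruferDomain

/-! ### Supports and splitting sets -/

theorem fracSupport_coeIdeal_subset {D : Type*} [CommRing D] [IsDomain D] (K : Type*) [Field K]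
    [Algebra D K] [IsFractionRing D K] (J : Ideal D) :
    fracSupport K (J : FractionalIdeal D⁰ K) ⊆ PrimeSpectrum.zeroLocus J := by
  intro P hP
  by_contra hJ
  obtain ⟨a, ha, haP⟩ := Set.not_subset.1 hJ
  refine hP (le_antisymm ?_ fun x hx => ?_)
  · rw [Submodule.mul_le]
    intro y hy z hz
    obtain ⟨y, -, rfl⟩ := (FractionalIdeal.mem_coeIdeal _).1 hy
    rw [← Algebra.smul_def]
    exact Submodule.smul_mem _ y hz
  · have ha0 : algebraMap D K a ≠ 0 := by
      rw [map_ne_zero_iff _ (IsFractionRing.injective D K)]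
      rintro rfl
      exact haP P.asIdeal.zero_mem
    have hinv : (algebraMap D K a)⁻¹ ∈ locAt K P := ⟨1, a, haP, by simp⟩
    rw [← mul_inv_cancel_left₀ ha0 x]
    exact Submodule.mul_mem_mul (FractionalIdeal.mem_coeIdeal_of_mem D⁰ ha)
      ((locAt K P).mul_mem hinv hx)

theorem IsSplittingSet.exists_fg_le_zeroLocus_subset {D : Type*} [CommRing D]
    {X : Set (PrimeSpectrum D)} (hX : IsSplittingSet X) {M : PrimeSpectrum D} (hM : M ∈ X) :
    ∃ J : Ideal D, J.FG ∧ J ≤ M.asIdeal ∧ PrimeSpectrum.zeroLocus (J : Set D) ⊆ X := by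
  obtain ⟨b, hbM, hb, hcover⟩ := hX.isCompact_compl.elim_finite_subcover_image
    (b := (M.asIdeal : Set D)) (c := fun f => (PrimeSpectrum.basicOpen f : Set (PrimeSpectrum D)))
    (fun f _ => (PrimeSpectrum.basicOpen f).isOpen) (by
      intro P hP
      obtain ⟨f, hf, hfP⟩ := Set.not_subset.1 fun h : (M.asIdeal : Set D) ⊆ P.asIdeal =>
        hP (hX.isUpperSet (PrimeSpectrum.asIdeal_le_asIdeal M P |>.1 h) hM)
      exact Set.mem_biUnion hf hfP)
  refine ⟨Ideal.span b, Submodule.fg_span hb, Ideal.span_le.2 hbM, fun P hP => ?_⟩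
  by_contra hPX
  obtain ⟨f, hf, hfP⟩ := Set.mem_iUnion₂.1 (hcover hPX)
  exact hfP (hP (Ideal.subset_span hf))

theorem mainTheorem4 {D : Type*} [CommRing D] [IsDomain D] (hD : IsPruferDomain D)
    (K : Type*) [Field K] [Algebra D K] [IsFractionRing D K]
    (X : Set (PrimeSpectrum D)) (hXne : X.Nonempty)
    (hXmax : ∀ P ∈ X, P.asIdeal.IsMaximal) (hX : IsDiscreteSplittingSet X) :
    critSet K X ≠ X := by
  intro hcrit
  have hrad : ∀ L : Ideal D, L.FG → L ≠ ⊤ → PrimeSpectrum.zeroLocus (L : Set D) ⊆ X →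
      ¬ L.IsRadical := by
    intro L hL hLtop hLX hLrad
    obtain ⟨M, hM, hLM⟩ := Ideal.exists_le_maximal L hLtop
    have hMcrit : (⟨M, hM.isPrime⟩ : PrimeSpectrum D) ∈ critSet K X := hcrit.symm ▸ hLX hLM
    have hL0 : L ≠ ⊥ := by
      rintro rfl
      have hbot : (⟨⊥, Ideal.isPrime_bot⟩ : PrimeSpectrum D) ∈ X :=
        hLX (subset_refl ((⊥ : Ideal D) : Set D))
      exact hX.ne_sq _ hbot (by simp [pow_two])
    obtain ⟨u, hu⟩ := hD.isUnit_coeIdeal K hL hL0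
    refine hMcrit.2 ⟨L, hLrad, hLM, u, ?_, hu⟩
    change fracSupport K (u : FractionalIdeal D⁰ K) ⊆ X
    rw [hu]
    exact (fracSupport_coeIdeal_subset K L).trans hLX
  let S := {L : Ideal D // L.FG ∧ L ≠ ⊤ ∧ PrimeSpectrum.zeroLocus (L : Set D) ⊆ X}
  have step : ∀ L : S, ∃ L' : S, L.1 ≤ L'.1 ∧ L.1 ≤ L'.1 ^ 2 := by
    rintro ⟨L, hL, hLtop, hLX⟩
    obtain ⟨L', hL', hL'top, hle, hsq⟩ := hD.exists_fg_le_sq hL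
      (fun N hN hLN => hX.ne_sq ⟨N, hN.isPrime⟩ (hLX hLN)) (hrad L hL hLtop hLX)
    exact ⟨⟨L', hL', hL'top, (PrimeSpectrum.zeroLocus_anti_mono hle).trans hLX⟩, hle, hsq⟩
  choose next hnext hsq using step
  obtain ⟨M₀, hM₀⟩ := hXne
  obtain ⟨J, hJ, hJM, hJX⟩ := hX.exists_fg_le_zeroLocus_subset hM₀
  let L : ℕ → S := fun n =>
    next^[n] ⟨J, hJ, fun h => M₀.isPrime.ne_top (top_le_iff.1 (h ▸ hJM)), hJX⟩
  have hL_succ : ∀ n, L (n + 1) = next (L n) := fun n => Function.iterate_succ_apply' next n _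
  have hmono : Monotone fun n => (L n).1 :=
    monotone_nat_of_le_succ fun n => by rw [hL_succ]; exact hnext _
  have hpow : ∀ n, J ≤ (L n).1 ^ 2 ^ n := by
    intro n
    induction n with
    | zero => simp [L]
    | succ n ih =>
      refine ih.trans ?_
      rw [hL_succ, pow_succ', pow_mul]
      exact Ideal.pow_right_mono (hsq _) _
  have hsup : ⨆ n, (L n).1 ≠ ⊤ := by
    rw [Ideal.ne_top_iff_one, Submodule.mem_iSup_of_directed _ hmono.directed_le]
    rintro ⟨n, hn⟩
    exact (L n).2.2.1 ((Ideal.eq_top_iff_one _).2 hn)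
  obtain ⟨M, hM, hLM⟩ := Ideal.exists_le_maximal _ hsup
  have hJM' : ∀ n, J ≤ M ^ n := fun n => (hpow n).trans
    ((Ideal.pow_right_mono ((le_iSup (fun n => (L n).1) n).trans hLM) _).trans
      (Ideal.pow_le_pow_right Nat.lt_two_pow_self.le))
  have hMX : (⟨M, hM.isPrime⟩ : PrimeSpectrum D) ∈ X :=
    hJX (show J ≤ M by simpa using hJM' 1)
  obtain ⟨t, ht, ht0, htM⟩ := hD.exists_le_locSpan (hX.ne_sq _ hMX)
  obtain ⟨hQ, htQ⟩ := hD.isPrime_iInf_locSpan_pow ht ht0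
  have hQX : (⟨_, hQ⟩ : PrimeSpectrum D) ∈ X :=
    hJX (show J ≤ _ from le_iInf fun n => (hJM' n).trans (le_locSpan_pow htM n))
  -- Elements of `X` are maximal ideals, so the prime in `hQX` would equal `M`.
  have hQM : ⨅ n : ℕ, locSpan M (t ^ n) ≤ M := by
    intro y hy
    obtain ⟨s, hs, h⟩ := Ideal.mem_iInf.1 hy 1
    exact (hM.isPrime.mem_or_mem (M.mem_of_dvd h (by simpa using ht))).resolve_left hs
  have hQeq := (hXmax _ hQX).eq_of_le hM.ne_top hQM
  exact htQ (hQeq.symm.le ht)
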